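/- All graphs are finite, undirected and simple. Let $p>1$ be an integer and write $e_p(G)=\sum_{v\in V(G)} d_G(v)^p$. A graph is 2-connected (resp. 2-edge-connected) if removing fewer than 2 vertices (resp. fewer than 2 edges) always leaves a connected graph; it is minimally 2-connected (resp. minimally 2-edge-connected) if in addition the deletion of any edge leaves a graph that is not 2-connected (resp. not 2-edge-connected). Let $K_{2,n-2}$ be the complete bipartite graph with parts of sizes $2$ and $n-2$, and let $F_n$ be the friendship graph on $n$ vertices: the star on $n$ vertices together with a maximum matching on its set of leaves. (i) If $G$ is a minimally 2-connected graph with $n\ge 4$ vertices, then $e_p(G)\le 2(n-2)^p+(n-2)2^p$, with equality if and only if $G\cong K_{2,n-2}$. (ii) If $G$ is a minimally 2-edge-connected graph with $n\ge 4$ vertices, then $e_p(G)\le\max\{e_p(F_n),e_p(K_{2,n-2})\}$. Equality holds if and only if either $n$ is odd, $G\cong F_n$ and $e_p(F_n)\ge e_p(K_{2,n-2})$, or $G\cong K_{2,n-2}$ and $e_p(K_{2,n-2})\ge e_p(F_n)$; in particular equality forces $G\cong F_n$ with $n$ odd, or $G\cong K_{2,n-2}$. Moreover, if $n$ is even, then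 $e_p(G)\le e_p(K_{2,n-2})$, with equality if and only if $G\cong K_{2,n-2}$. -/

import Mathlib

/-- The degree power `e_p(G) = ∑ v, d_G(v) ^ p`. -/
def degreePower {V : Type*} [Fintype V] (G : SimpleGraph V) [DecidableRel G.Adj] (p : ℕ) : ℕ :=
  ∑ v, G.degree v ^ p

/-- `G` is `t`-connected: removing fewer than `t` vertices always leaves a connected graph. -/
def IsTConnected {V : Type*} (G : SimpleGraph V) (t : ℕ) : Prop :=
  ∀ S : Finset V, S.card < t → (G.induce {v | v ∉ S}).Connected

/-- `G` is minimally `t`-connected: it is `t`-connected, and deleting any edge destroys this. -/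
def IsMinimallyConnected {V : Type*} (G : SimpleGraph V) (t : ℕ) : Prop :=
  IsTConnected G t ∧ ∀ e ∈ G.edgeSet, ¬ IsTConnected (G.deleteEdges {e}) t

/-- `G` is minimally `t`-edge-connected: it is `t`-edge-connected, and deleting any edge
destroys this. -/
def IsMinimallyEdgeConnected {V : Type*} (G : SimpleGraph V) (t : ℕ) : Prop :=
  G.IsEdgeConnected t ∧ ∀ e ∈ G.edgeSet, ¬ (G.deleteEdges {e}).IsEdgeConnected t

/-- The friendship graph `F_n` on `{0, …, n - 1}`: the star with center `0` together with the
maximum matching `{1, 2}, {3, 4}, …` on its leaves (for even `n` the leaf `n - 1` is unmatched). -/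
def friendshipGraph (n : ℕ) : SimpleGraph (Fin n) where
  Adj i j := i ≠ j ∧ (i.val = 0 ∨ j.val = 0 ∨ (i.val + 1) / 2 = (j.val + 1) / 2)
  symm := ⟨fun _ _ h => ⟨h.1.symm, by
    rcases h.2 with h | h | h
    · exact Or.inr (Or.inl h)
    · exact Or.inl h
    · exact Or.inr (Or.inr h.symm)⟩⟩
  loopless := ⟨fun _ h => h.1 rfl⟩

instance (n : ℕ) : DecidableRel (friendshipGraph n).Adj := fun i j =>
  inferInstanceAs (Decidable (i ≠ j ∧ (i.val = 0 ∨ j.val = 0 ∨ (i.val + 1) / 2 = (j.val + 1) / 2)))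

instance (V W : Type*) : DecidableRel (completeBipartiteGraph V W).Adj := fun v w =>
  inferInstanceAs (Decidable ((v.isLeft ∧ w.isRight) ∨ (v.isRight ∧ w.isLeft)))

/-!
Both kinds of minimal graphs have no cycle with a chord: deleting a chord leaves two disjoint arcs
between its ends, so that 2-connectivity and 2-edge-connectivity survive. All else uses only this
fact and that all degrees are at least 2.

By Pósa's theorem (`card_edgeFinset_add_four_le`) a graph on `n ≥ 4` vertices without chorded cycles
has at most `2 n - 4` edges, so its degrees sum to at most `4 (n - 2)`. If moreover no vertex is
dominating, all degrees lie between 2 and `n - 2`, and by convexity (`sum_pow_le`) the degree power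
is largest when two degrees are `n - 2` and the others are 2. For `p > 1` no other degree sequence
attains the maximum (`exists_of_sum_pow_eq`), and the absence of chorded cycles forces a graph with
these degrees to be `K_{2,n-2}` (`nonempty_iso_of_degrees`).

If there is a dominating vertex `c`, then no two edges of `G - c` share a vertex, since they would
give a 4-cycle through `c` with a chord. As all degrees are at least 2, the graph is a windmill of
triangles. Hence `n` is odd and `G` is isomorphic to `F_n` (`IsWindmill.nonempty_iso`), and `c` is a
cut vertex, which excludes this case for 2-connected graphs.
-/

open SimpleGraph

/-! ### Chorded cycles -/

/-- `G` has a cycle with a chord: the cycle is `f 0, f 1, …, f m` (and back to `f 0`), and the chord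
joins `f 0` to `f i`, where `2 ≤ i < m`. The values of `f` beyond `m` are irrelevant. -/
def HasChordedCycle {V : Type*} (G : SimpleGraph V) : Prop :=
  ∃ (f : ℕ → V) (m i : ℕ), 2 ≤ i ∧ i < m ∧ Set.InjOn f (Set.Iic m) ∧
    (∀ j < m, G.Adj (f j) (f (j + 1))) ∧ G.Adj (f 0) (f m) ∧ G.Adj (f 0) (f i)

theorem HasChordedCycle.of_induce {V : Type*} {G : SimpleGraph V} {s : Set V}
    (h : HasChordedCycle (G.induce s)) : HasChordedCycle G := by
  obtain ⟨f, m, i, hi, him, hinj, hadj, hm, hc⟩ := h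
  exact ⟨fun j => f j, m, i, hi, him, fun a ha b hb hab => hinj ha hb (Subtype.ext hab),
    hadj, hm, hc⟩

theorem hasChordedCycle_of_four {V : Type*} {G : SimpleGraph V} {a b c d : V}
    (hab : G.Adj a b) (hbc : G.Adj b c) (hcd : G.Adj c d) (hda : G.Adj d a) (hac : G.Adj a c)
    (hbd : b ≠ d) : HasChordedCycle G := by
  refine ⟨fun j => match j with | 0 => a | 1 => b | 2 => c | _ => d, 3, 2, le_rfl, by norm_num,
    ?_, ?_, hda.symm, hac⟩
  · intro x hx y hy hxy
    have := hab.ne; have := hbc.ne; have := hcd.ne; have := hda.ne; have := hac.ne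
    simp only [Set.mem_Iic] at hx hy
    interval_cases x <;> interval_cases y <;> simp_all
  · intro j hj
    interval_cases j <;> assumption

theorem hasChordedCycle_of_five {V : Type*} {G : SimpleGraph V} {a b c d e : V}
    (hab : G.Adj a b) (hbc : G.Adj b c) (hcd : G.Adj c d) (hde : G.Adj d e) (hea : G.Adj e a)
    (hac : G.Adj a c) (hbd : b ≠ d) (hbe : b ≠ e) (hce : c ≠ e) (had : a ≠ d) :
    HasChordedCycle G := by
  refine ⟨fun j => match j with | 0 => a | 1 => b | 2 => c | 3 => d | _ => e, 4, 2, le_rfl,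
    by norm_num, ?_, ?_, hea.symm, hac⟩
  · intro x hx y hy hxy
    have := hab.ne; have := hbc.ne; have := hcd.ne; have := hde.ne; have := hea.ne
    have := hac.ne
    simp only [Set.mem_Iic] at hx hy
    interval_cases x <;> interval_cases y <;> simp_all
  · intro j hj
    interval_cases j <;> assumption

theorem reachable_induce_of_chain {V : Type*} {G : SimpleGraph V} {s : Set V} {f : ℕ → V}
    {a b : ℕ} (hab : a ≤ b) (hs : ∀ j, a ≤ j → j ≤ b → f j ∈ s)
    (hadj : ∀ j, a ≤ j → j < b → G.Adj (f j) (f (j + 1))) :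
    (G.induce s).Reachable ⟨f a, hs a le_rfl hab⟩ ⟨f b, hs b hab le_rfl⟩ := by
  induction b, hab using Nat.le_induction with
  | base => exact .rfl
  | succ b hab ih =>
    refine (ih (fun j h1 h2 => hs j h1 (by omega)) fun j h1 h2 => hadj j h1 (by omega)).trans ?_
    exact Adj.reachable (G := G.induce s) (hadj b hab (by omega))

theorem reachable_of_chain {V : Type*} {G : SimpleGraph V} {f : ℕ → V} {a b : ℕ} (hab : a ≤ b)
    (hadj : ∀ j, a ≤ j → j < b → G.Adj (f j) (f (j + 1))) : G.Reachable (f a) (f b) :=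
  (reachable_induce_of_chain (s := Set.univ) hab (fun _ _ _ => trivial) hadj).map
    (Embedding.induce _).toHom

theorem preconnected_of_adj_imp_reachable {V : Type*} {G H : SimpleGraph V} (hG : G.Preconnected)
    (h : ∀ u v, G.Adj u v → H.Reachable u v) : H.Preconnected := by
  intro u v
  obtain ⟨w⟩ := hG u v
  induction w with
  | nil => exact .rfl
  | cons hadj _ ih => exact (h _ _ hadj).trans ih

/-! ### Minimal graphs have no chorded cycles -/

theorem edge_ne_chord {V : Type*} {f : ℕ → V} {m i : ℕ} (hi : 2 ≤ i) (him : i < m)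
    (hinj : Set.InjOn f (Set.Iic m)) :
    (∀ j < m, s(f j, f (j + 1)) ≠ s(f 0, f i)) ∧ s(f 0, f m) ≠ s(f 0, f i) := by
  refine ⟨fun j hj h => ?_, fun h => ?_⟩
  · rcases Sym2.eq_iff.1 h with ⟨h1, h2⟩ | ⟨h1, h2⟩
    · have := hinj (by simp; omega) (by simp) h1
      have := hinj (by simp; omega) (by simp; omega) h2
      omega
    · have := hinj (by simp; omega) (by simp) h2
      omega
  · rcases Sym2.eq_iff.1 h with ⟨-, h2⟩ | ⟨-, h2⟩
    · exact him.ne' (hinj (by simp) (by simp; omega) h2)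
    · have := hinj (by simp) (by simp) h2
      omega

/-- Deleting a chord of a cycle keeps a graph 2-edge-connected, since a further edge can only
break one of the two arcs of the cycle between the ends of the chord. -/
theorem IsMinimallyEdgeConnected.not_hasChordedCycle {V : Type*} {G : SimpleGraph V}
    (hG : IsMinimallyEdgeConnected G 2) : ¬ HasChordedCycle G := by
  rintro ⟨f, m, i, hi, him, hinj, hadj, hm, hc⟩
  refine hG.2 s(f 0, f i) hc ((isEdgeConnected_add_one one_ne_zero).2 fun e => ?_)
  have hG1 := (isEdgeConnected_add_one one_ne_zero).1 hG.1 e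
  rw [isEdgeConnected_one] at hG1 ⊢
  have hne : ∀ {a b}, a ≤ m → b ≤ m → a ≠ b → f a ≠ f b := fun ha hb hab h => hab (hinj ha hb h)
  obtain ⟨hchord, hlast⟩ := edge_ne_chord hi him hinj
  have key : ((G.deleteEdges {s(f 0, f i)}).deleteEdges {e}).Reachable (f 0) (f i) := by
    by_cases he : ∃ j < i, s(f j, f (j + 1)) = e
    · obtain ⟨k, hk, rfl⟩ := he
      have h1 : ((G.deleteEdges {s(f 0, f i)}).deleteEdges {s(f k, f (k + 1))}).Reachable
          (f i) (f m) := by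
        refine reachable_of_chain him.le fun j h1 h2 => ?_
        simp only [deleteEdges_adj, Set.mem_singleton_iff]
        refine ⟨⟨hadj j h2, hchord j h2⟩, fun h => ?_⟩
        rcases Sym2.eq_iff.1 h with ⟨h3, -⟩ | ⟨-, h3⟩
        · exact hne (by omega) (by omega) (by omega) h3
        · exact hne (by omega) (by omega) (by omega) h3
      refine (Adj.reachable ?_).trans h1.symm
      simp only [deleteEdges_adj, Set.mem_singleton_iff]
      refine ⟨⟨hm, hlast⟩, fun h => ?_⟩
      rcases Sym2.eq_iff.1 h with ⟨-, h3⟩ | ⟨-, h3⟩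
      · exact hne (by omega) (by omega) (by omega) h3
      · exact hne (by omega) (by omega) (by omega) h3
    · push Not at he
      refine reachable_of_chain (Nat.zero_le i) fun j _ h2 => ?_
      simp only [deleteEdges_adj, Set.mem_singleton_iff]
      exact ⟨⟨hadj j (by omega), hchord j (by omega)⟩, he j h2⟩
  refine preconnected_of_adj_imp_reachable hG1 fun u v huv => ?_
  by_cases h : s(u, v) = s(f 0, f i)
  · rcases Sym2.eq_iff.1 h with ⟨rfl, rfl⟩ | ⟨rfl, rfl⟩
    · exact key
    · exact key.symm
  · refine Adj.reachable ?_
    simp only [deleteEdges_adj, Set.mem_singleton_iff] at huv ⊢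
    exact ⟨⟨huv.1, h⟩, huv.2⟩

/-- Deleting a chord of a cycle keeps a graph 2-connected, since a further vertex can only
break one of the two arcs of the cycle between the ends of the chord. -/
theorem IsMinimallyConnected.not_hasChordedCycle {V : Type*} {G : SimpleGraph V}
    (hG : IsMinimallyConnected G 2) : ¬ HasChordedCycle G := by
  rintro ⟨f, m, i, hi, him, hinj, hadj, hm, hc⟩
  refine hG.2 s(f 0, f i) hc fun S hS => ?_
  have hconn := hG.1 S hS
  have := hconn.nonempty
  refine ⟨preconnected_of_adj_imp_reachable hconn.preconnected ?_⟩
  have hne : ∀ {a b}, a ≤ m → b ≤ m → a ≠ b → f a ≠ f b := fun ha hb hab h => hab (hinj ha hb h)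
  obtain ⟨hchord, hlast⟩ := edge_ne_chord hi him hinj
  have hS1 : ∀ x ∈ S, ∀ y ∈ S, x = y := Finset.card_le_one.1 (by omega)
  have key : ∀ (h0 : f 0 ∉ S) (h1 : f i ∉ S),
      ((G.deleteEdges {s(f 0, f i)}).induce {v | v ∉ S}).Reachable ⟨f 0, h0⟩ ⟨f i, h1⟩ := by
    intro h0 h1
    by_cases he : ∃ k ≤ i, f k ∈ S
    · obtain ⟨k, hk, hkS⟩ := he
      have hki : k ≠ i := by rintro rfl; exact h1 hkS
      have hmem : ∀ j, i ≤ j → j ≤ m → f j ∈ {v | v ∉ S} := fun j hj hjm hjS =>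
        hne (by omega) hjm (by omega) (hS1 _ hkS _ hjS)
      have h2 : ((G.deleteEdges {s(f 0, f i)}).induce {v | v ∉ S}).Reachable
          ⟨f i, h1⟩ ⟨f m, hmem m him.le le_rfl⟩ :=
        reachable_induce_of_chain him.le hmem fun j _ h2 => by
          simp only [deleteEdges_adj, Set.mem_singleton_iff]
          exact ⟨hadj j h2, hchord j h2⟩
      refine (Adj.reachable ?_).trans h2.symm
      simp only [comap_adj, Function.Embedding.subtype_apply, deleteEdges_adj,
        Set.mem_singleton_iff]
      exact ⟨hm, hlast⟩
    · push Not at he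
      refine reachable_induce_of_chain (Nat.zero_le i) (fun j _ hj => he j hj) fun j _ h2 => ?_
      simp only [deleteEdges_adj, Set.mem_singleton_iff]
      exact ⟨hadj j (by omega), hchord j (by omega)⟩
  rintro ⟨u, hu⟩ ⟨v, hv⟩ huv
  by_cases h : s(u, v) = s(f 0, f i)
  · rcases Sym2.eq_iff.1 h with ⟨rfl, rfl⟩ | ⟨rfl, rfl⟩
    · exact key hu hv
    · exact (key hv hu).symm
  · refine Adj.reachable ?_
    simp only [comap_adj, Function.Embedding.subtype_apply, deleteEdges_adj,
      Set.mem_singleton_iff] at huv ⊢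
    exact ⟨huv, h⟩

theorem IsTConnected.two_le_degree {V : Type*} [Fintype V] {G : SimpleGraph V}
    [DecidableRel G.Adj] (hG : IsTConnected G 2) (hV : 4 ≤ Fintype.card V) (v : V) :
    2 ≤ G.degree v := by
  classical
  by_contra! hlt
  have hconn := hG (G.neighborFinset v) hlt
  obtain ⟨w, hw⟩ : ∃ w, w ∉ insert v (G.neighborFinset v) := by
    by_contra! h
    have h1 := Finset.card_le_card (fun x _ => h x : (Finset.univ : Finset V) ⊆ _)
    have h2 := Finset.card_insert_le v (G.neighborFinset v)
    rw [card_neighborFinset_eq_degree] at h2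
    rw [Finset.card_univ] at h1
    omega
  simp only [Finset.mem_insert, not_or] at hw
  have : Nontrivial {x | x ∉ G.neighborFinset v} :=
    ⟨⟨v, by simp⟩, ⟨w, hw.2⟩, fun h => hw.1 (congrArg Subtype.val h).symm⟩
  obtain ⟨⟨x, hx⟩, hvx⟩ := hconn.preconnected.exists_adj_of_nontrivial ⟨v, by simp⟩
  exact hx (by simpa using hvx)

/-! ### Pósa's bound on the number of edges of a graph without chorded cycles -/

/-- The end of a longest path has all its neighbours on the path, and three of them would give
a chorded cycle. -/
theorem exists_degree_le_two {V : Type*} [Fintype V] [Nonempty V] {G : SimpleGraph V}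
    [DecidableRel G.Adj] (h : ¬ HasChordedCycle G) : ∃ v, G.degree v ≤ 2 := by
  classical
  obtain ⟨u, w, q, hq, hmax⟩ := Walk.exists_isPath_forall_isPath_length_le_length G
  refine ⟨u, ?_⟩
  by_contra! hdeg
  set I := (Finset.Icc 1 q.length).filter fun j => G.Adj u (q.getVert j) with hI
  have hsub : G.neighborFinset u ⊆ I.image q.getVert := by
    intro x hx
    rw [mem_neighborFinset] at hx
    have hxs : x ∈ q.support := by
      by_contra hxs
      have := hmax _ _ (Walk.cons hx.symm q) ((Walk.cons_isPath_iff _ _).2 ⟨hq, hxs⟩)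
      simp at this
    obtain ⟨j, rfl, hj⟩ := Walk.mem_support_iff_exists_getVert.1 hxs
    refine Finset.mem_image_of_mem _ ?_
    simp only [hI, Finset.mem_filter, Finset.mem_Icc]
    refine ⟨⟨Nat.one_le_iff_ne_zero.2 ?_, hj⟩, hx⟩
    rintro rfl
    simp at hx
  have hcard : 3 ≤ I.card :=
    hdeg.trans_le ((Finset.card_le_card hsub).trans Finset.card_image_le)
  -- a chord `f 0, f i` needs `i ≥ 2`, and three indices leave two of them different from 1
  have h2 : 1 < (I.erase 1).card := by
    have := Finset.pred_card_le_card_erase (s := I) (a := 1)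
    omega
  have main : ∀ i j, i ∈ I.erase 1 → j ∈ I.erase 1 → i < j → False := by
    intro i j hi hj hij
    simp only [hI, Finset.mem_erase, Finset.mem_filter, Finset.mem_Icc] at hi hj
    refine h ⟨q.getVert, j, i, by omega, hij, ?_, fun k hk => q.adj_getVert_succ (by omega), ?_, ?_⟩
    · exact hq.getVert_injOn.mono fun k hk => le_trans (Set.mem_Iic.1 hk) hj.2.1.2
    · rw [q.getVert_zero]; exact hj.2.2
    · rw [q.getVert_zero]; exact hi.2.2
  obtain ⟨i, hi, j, hj, hij⟩ := Finset.one_lt_card.1 h2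
  rcases lt_or_gt_of_ne hij with h3 | h3
  · exact main i j hi hj h3
  · exact main j i hj hi h3

theorem adj_of_card_le_degree_add_one {V : Type*} [Fintype V] {G : SimpleGraph V}
    [DecidableRel G.Adj] {c : V} (hc : Fintype.card V ≤ G.degree c + 1) {x : V} (hx : x ≠ c) :
    G.Adj c x := by
  classical
  by_contra hn
  have hsub : G.neighborFinset c ⊆ (Finset.univ.erase c).erase x := by
    intro y hy
    rw [mem_neighborFinset] at hy
    simp only [Finset.mem_erase, Finset.mem_univ, and_true]
    exact ⟨by rintro rfl; exact hn hy, hy.ne'⟩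
  have h1 := Finset.card_le_card hsub
  rw [card_neighborFinset_eq_degree, Finset.card_erase_of_mem (by simp [hx]),
    Finset.card_erase_of_mem (by simp), Finset.card_univ] at h1
  have := Fintype.one_lt_card_iff.2 ⟨x, c, hx⟩
  omega

/-- Two neighbours `y`, `z` of `x` other than the dominating vertex `c` give the cycle
`c, y, x, z` with chord `c x`. -/
theorem eq_of_adj_of_dominating {V : Type*} {G : SimpleGraph V} (h : ¬ HasChordedCycle G) {c : V}
    (hc : ∀ x ≠ c, G.Adj c x) {x y z : V} (hx : x ≠ c) (hy : y ≠ c) (hz : z ≠ c)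
    (hxy : G.Adj x y) (hxz : G.Adj x z) : y = z := by
  by_contra hyz
  exact h (hasChordedCycle_of_four (hc y hy) hxy.symm hxz (hc z hz).symm (hc x hx) hyz)

theorem degree_le_two_of_dominating {V : Type*} [Fintype V] {G : SimpleGraph V}
    [DecidableRel G.Adj] (h : ¬ HasChordedCycle G) {c : V} (hc : ∀ x ≠ c, G.Adj c x)
    {x : V} (hx : x ≠ c) : G.degree x ≤ 2 := by
  classical
  have : ((G.neighborFinset x).erase c).card ≤ 1 := by
    refine Finset.card_le_one.2 fun y hy z hz => ?_
    simp only [Finset.mem_erase, mem_neighborFinset] at hy hz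
    exact eq_of_adj_of_dominating h hc hx hy.1 hz.1 hy.2 hz.2
  have h2 := Finset.pred_card_le_card_erase (s := G.neighborFinset x) (a := c)
  rw [card_neighborFinset_eq_degree] at h2
  omega

/-- **Pósa's theorem**: a graph on `n ≥ 4` vertices without chorded cycles has at most `2 n - 4`
edges. -/
theorem card_edgeFinset_add_four_le {V : Type*} [Fintype V] (G : SimpleGraph V)
    [DecidableRel G.Adj] (h : ¬ HasChordedCycle G) (hV : 4 ≤ Fintype.card V) :
    G.edgeFinset.card + 4 ≤ 2 * Fintype.card V := by
  classical
  obtain ⟨n, hn⟩ : ∃ n, Fintype.card V = n := ⟨_, rfl⟩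
  rw [hn] at hV ⊢
  induction n, hV using Nat.le_induction generalizing V with
  | base =>
    have hsum := G.sum_degrees_eq_twice_card_edges
    by_cases hd : ∃ c, 3 ≤ G.degree c
    · obtain ⟨c, hc⟩ := hd
      have hdom : ∀ x ≠ c, G.Adj c x := fun x hx => adj_of_card_le_degree_add_one (by omega) hx
      have hle := G.degree_lt_card_verts c
      rw [← Finset.add_sum_erase _ _ (Finset.mem_univ c)] at hsum
      have hrest : ∑ x ∈ Finset.univ.erase c, G.degree x ≤ ∑ x ∈ Finset.univ.erase c, 2 :=
        Finset.sum_le_sum fun x hx => degree_le_two_of_dominating h hdom (Finset.ne_of_mem_erase hx)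
      rw [Finset.sum_const, Finset.card_erase_of_mem (Finset.mem_univ c), Finset.card_univ, hn,
        smul_eq_mul] at hrest
      omega
    · push Not at hd
      have hle : ∑ x, G.degree x ≤ ∑ _x : V, 2 :=
        Finset.sum_le_sum fun x _ => Nat.le_of_lt_succ (hd x)
      rw [Finset.sum_const, Finset.card_univ, hn, smul_eq_mul] at hle
      omega
  | succ n hn4 ih =>
    have : Nonempty V := Fintype.card_pos_iff.1 (by omega)
    obtain ⟨v, hv⟩ := exists_degree_le_two h
    have h1 := ih (G.induce {v}ᶜ) (fun h' => h h'.of_induce)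
      (by rw [Fintype.card_compl_set, hn, Fintype.card_unique]; omega)
    rw [card_edgeFinset_induce_compl_singleton, card_edgeFinset_deleteIncidenceSet] at h1
    omega

/-! ### Power sums with prescribed bounds -/

/-- Convexity of `x ↦ x ^ p`: at `d ∈ [2, N]` it lies below its secant through `2` and `N`, stated
without division. -/
theorem pow_le_secant {N d : ℕ} (h2 : 2 ≤ d) (hN : d ≤ N) (p : ℕ) :
    ((N : ℤ) - 2) * d ^ p ≤ (d - 2) * N ^ p + (N - d) * 2 ^ p := by
  induction p with
  | zero => simp
  | succ p ih =>
    have hd : (2 : ℤ) ≤ d := by exact_mod_cast h2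
    have hN' : (d : ℤ) ≤ N := by exact_mod_cast hN
    have hp : (2 : ℤ) ^ p ≤ N ^ p := by gcongr; omega
    have h1 := mul_le_mul_of_nonneg_left ih (by omega : (0 : ℤ) ≤ d)
    have h3 : 0 ≤ ((d : ℤ) - 2) * (N - d) * (N ^ p - 2 ^ p) :=
      mul_nonneg (mul_nonneg (by omega) (by omega)) (by omega)
    calc ((N : ℤ) - 2) * d ^ (p + 1) = d * ((N - 2) * d ^ p) := by ring
      _ ≤ _ := h1
      _ ≤ _ := by rw [← sub_nonneg]; exact h3.trans_eq (by ring)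

theorem pow_lt_secant {N d p : ℕ} (h2 : 2 < d) (hN : d < N) (hp : 1 < p) :
    ((N : ℤ) - 2) * d ^ p < (d - 2) * N ^ p + (N - d) * 2 ^ p := by
  obtain ⟨p, rfl⟩ : ∃ q, p = q + 1 := ⟨p - 1, by omega⟩
  have hd : (2 : ℤ) < d := by exact_mod_cast h2
  have hN' : (d : ℤ) < N := by exact_mod_cast hN
  have hlt : (2 : ℤ) ^ p < N ^ p := pow_lt_pow_left₀ (by omega) (by norm_num) (by omega)
  have h1 := mul_le_mul_of_nonneg_left (pow_le_secant h2.le hN.le p) (by omega : (0 : ℤ) ≤ d)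
  have h3 : 0 < ((d : ℤ) - 2) * (N - d) * (N ^ p - 2 ^ p) :=
    mul_pos (mul_pos (by omega) (by omega)) (by omega)
  calc ((N : ℤ) - 2) * d ^ (p + 1) = d * ((N - 2) * d ^ p) := by ring
    _ ≤ _ := h1
    _ < _ := by rw [← sub_pos]; exact h3.trans_eq (by ring)

/-- Under these constraints the power sum is largest for the degrees of `K_{2,N}`, that is, two
values `N` and `N` values `2`; `exists_of_sum_pow_eq` says that this is the only maximizer. -/
theorem sum_pow_le {V : Type*} [Fintype V] {d : V → ℕ} {N p : ℕ} (hN : 2 ≤ N)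
    (hV : Fintype.card V = N + 2) (hd2 : ∀ v, 2 ≤ d v) (hdN : ∀ v, d v ≤ N)
    (hsum : ∑ v, d v ≤ 4 * N) :
    ∑ v, d v ^ p ≤ 2 * N ^ p + N * 2 ^ p := by
  rcases hN.eq_or_lt with rfl | hN
  · have : ∀ v, d v = 2 := fun v => le_antisymm (hdN v) (hd2 v)
    simp only [this, Finset.sum_const, Finset.card_univ, hV, smul_eq_mul]
    omega
  have h1 := Finset.sum_le_sum fun v (_ : v ∈ Finset.univ) => pow_le_secant (hd2 v) (hdN v) p
  rw [← Finset.mul_sum, Finset.sum_add_distrib, ← Finset.sum_mul, ← Finset.sum_mul,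
    Finset.sum_sub_distrib, Finset.sum_sub_distrib] at h1
  simp only [Finset.sum_const, Finset.card_univ, hV, nsmul_eq_mul] at h1
  have hs : ∑ v, (d v : ℤ) ≤ 4 * N := by exact_mod_cast hsum
  have hp : (2 : ℤ) ^ p ≤ N ^ p := by gcongr; omega
  have h2 := mul_nonneg (sub_nonneg.2 hs) (sub_nonneg.2 hp)
  have h3 : ((N : ℤ) - 2) * ∑ v, (d v : ℤ) ^ p ≤ (N - 2) * (2 * N ^ p + N * 2 ^ p) := by
    push_cast at h1
    linarith
  have h4 := le_of_mul_le_mul_left h3 (by omega)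
  exact_mod_cast h4

theorem exists_of_sum_pow_eq {V : Type*} [Fintype V] {d : V → ℕ} {N p : ℕ} (hN : 2 ≤ N)
    (hp : 1 < p)
    (hV : Fintype.card V = N + 2) (hd2 : ∀ v, 2 ≤ d v) (hdN : ∀ v, d v ≤ N)
    (hsum : ∑ v, d v ≤ 4 * N) (heq : ∑ v, d v ^ p = 2 * N ^ p + N * 2 ^ p) :
    ∃ a b, a ≠ b ∧ d a = N ∧ d b = N ∧ ∀ v, v ≠ a → v ≠ b → d v = 2 := by
  classical
  rcases hN.eq_or_lt with rfl | hN
  · have : ∀ v, d v = 2 := fun v => le_antisymm (hdN v) (hd2 v)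
    obtain ⟨a, b, hab⟩ := Fintype.one_lt_card_iff.1 (by omega : 1 < Fintype.card V)
    exact ⟨a, b, hab, this a, this b, fun v _ _ => this v⟩
  have hs : ∑ v, (d v : ℤ) ≤ 4 * N := by exact_mod_cast hsum
  have hlt : (2 : ℤ) ^ p < N ^ p := pow_lt_pow_left₀ (by omega) (by norm_num) (by omega)
  have heq' : ∑ v, (d v : ℤ) ^ p = 2 * N ^ p + N * 2 ^ p := by exact_mod_cast heq
  have hR : ∑ v, (((d v : ℤ) - 2) * N ^ p + (N - d v) * 2 ^ p) =
      (N - 2) * ∑ v, (d v : ℤ) ^ p - (4 * N - ∑ v, (d v : ℤ)) * (N ^ p - 2 ^ p) := by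
    rw [heq', Finset.sum_add_distrib, ← Finset.sum_mul, ← Finset.sum_mul,
      Finset.sum_sub_distrib, Finset.sum_sub_distrib]
    simp only [Finset.sum_const, Finset.card_univ, hV, nsmul_eq_mul]
    push_cast
    ring
  have hle := fun v (_ : v ∈ Finset.univ) => pow_le_secant (hd2 v) (hdN v) p
  have h1 := Finset.sum_le_sum hle
  rw [hR, ← Finset.mul_sum] at h1
  -- equality in the convexity bound leaves no slack in the degree sum
  have hs4 : ∑ v, (d v : ℤ) = 4 * N := by
    by_contra hne
    have := mul_pos (sub_pos.2 (lt_of_le_of_ne hs hne)) (sub_pos.2 hlt)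
    linarith
  have h2 := (Finset.sum_eq_sum_iff_of_le hle).1 (by rw [hR, hs4, ← Finset.mul_sum]; ring)
  have hdich : ∀ v, d v = N ∨ d v = 2 := by
    intro v
    by_contra! hv
    have h3 := pow_lt_secant (lt_of_le_of_ne (hd2 v) hv.2.symm) (lt_of_le_of_ne (hdN v) hv.1) hp
    exact h3.ne (h2 v (Finset.mem_univ v))
  have hcount : ∑ v, ((d v : ℤ) - 2) = ((Finset.univ.filter fun v => d v = N).card : ℤ) * (N - 2) := by
    have hite : ∀ v, ((d v : ℤ) - 2) = if d v = N then (N : ℤ) - 2 else 0 := by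
      intro v
      split_ifs with hv
      · rw [hv]
      · rw [(hdich v).resolve_left hv]; rfl
    simp only [hite]
    rw [← Finset.sum_filter, Finset.sum_const, nsmul_eq_mul]
  have hcard : (Finset.univ.filter fun v => d v = N).card = 2 := by
    rw [Finset.sum_sub_distrib, hs4, Finset.sum_const, Finset.card_univ, hV] at hcount
    have h5 : ((N : ℤ) - 2) * ((Finset.univ.filter fun v => d v = N).card : ℤ) = (N - 2) * 2 := by
      simp only [nsmul_eq_mul] at hcount
      push_cast at hcount
      linarith
    exact_mod_cast mul_left_cancel₀ (by omega) h5
  obtain ⟨a, b, hab, hset⟩ := Finset.card_eq_two.1 hcard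
  have hmem : ∀ v, d v = N ↔ v = a ∨ v = b := by
    intro v
    have := Finset.ext_iff.1 hset v
    simpa using this
  refine ⟨a, b, hab, (hmem a).2 (Or.inl rfl), (hmem b).2 (Or.inr rfl), fun v ha hb => ?_⟩
  exact (hdich v).resolve_left fun h => ((hmem v).1 h).elim ha hb

/-! ### Recognizing the complete bipartite graph -/

theorem degreePower_congr {V W : Type*} [Fintype V] [Fintype W] {G : SimpleGraph V}
    {H : SimpleGraph W} [DecidableRel G.Adj] [DecidableRel H.Adj] (φ : G ≃g H) (p : ℕ) :
    degreePower G p = degreePower H p :=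
  Fintype.sum_equiv φ.toEquiv _ _ fun v => by
    have := φ.degree_eq v
    simp only [RelIso.coe_fn_toEquiv, this]

theorem degreePower_completeBipartiteGraph (m p : ℕ) :
    degreePower (completeBipartiteGraph (Fin 2) (Fin m)) p = 2 * m ^ p + m * 2 ^ p := by
  have hl : ∀ i : Fin 2, (completeBipartiteGraph (Fin 2) (Fin m)).degree (.inl i) = m := by
    intro i
    rw [← card_neighborFinset_eq_degree]
    have : (completeBipartiteGraph (Fin 2) (Fin m)).neighborFinset (.inl i) =
        Finset.univ.map Function.Embedding.inr := by
      ext x; cases x <;> simp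
    rw [this, Finset.card_map, Finset.card_univ, Fintype.card_fin]
  have hr : ∀ i : Fin m, (completeBipartiteGraph (Fin 2) (Fin m)).degree (.inr i) = 2 := by
    intro i
    rw [← card_neighborFinset_eq_degree]
    have : (completeBipartiteGraph (Fin 2) (Fin m)).neighborFinset (.inr i) =
        Finset.univ.map Function.Embedding.inl := by
      ext x; cases x <;> simp
    rw [this, Finset.card_map, Finset.card_univ, Fintype.card_fin]
  simp [degreePower, Fintype.sum_sum_type, hl, hr]

theorem nonempty_iso_completeBipartiteGraph {V : Type*} [Fintype V] {G : SimpleGraph V}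
    {n : ℕ} (hV : Fintype.card V = n + 2) {a b : V} (hab : a ≠ b)
    (hadj : ∀ x y, G.Adj x y ↔ ((x = a ∨ x = b) ∧ ¬ (y = a ∨ y = b)) ∨
      (¬ (x = a ∨ x = b) ∧ (y = a ∨ y = b))) :
    Nonempty (G ≃g completeBipartiteGraph (Fin 2) (Fin n)) := by
  classical
  have h2 : Fintype.card {x // x = a ∨ x = b} = 2 := by
    rw [Fintype.card_subtype, ← Finset.card_pair hab]
    congr 1; ext; simp
  have hn : Fintype.card {x // ¬ (x = a ∨ x = b)} = n := by
    rw [Fintype.card_subtype_compl, h2, hV]; rfl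
  let e : V ≃ Fin 2 ⊕ Fin n := (Equiv.sumCompl fun x => x = a ∨ x = b).symm.trans
    (Equiv.sumCongr (Fintype.equivFinOfCardEq h2) (Fintype.equivFinOfCardEq hn))
  have hL : ∀ x, (e x).isLeft = true ↔ x = a ∨ x = b := by
    intro x
    by_cases hx : x = a ∨ x = b
    · simp [e, hx]
    · simp [e, hx]
  have hR : ∀ x, (e x).isRight = true ↔ ¬ (x = a ∨ x = b) := by
    intro x
    rw [← hL, ← Sum.not_isLeft]
  refine ⟨⟨e, fun {x y} => ?_⟩⟩
  simp only [completeBipartiteGraph_adj, hL, hR, hadj]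

theorem nonempty_iso_of_not_adj {V : Type*} [Fintype V] {G : SimpleGraph V} [DecidableRel G.Adj]
    {n : ℕ} (hV : Fintype.card V = n + 2) {a b : V} (hab : a ≠ b)
    (hnadj : ¬ G.Adj a b) (ha : G.degree a = n) (hb : G.degree b = n)
    (hd : ∀ v, v ≠ a → v ≠ b → G.degree v = 2) :
    Nonempty (G ≃g completeBipartiteGraph (Fin 2) (Fin n)) := by
  classical
  have hcard : ((Finset.univ.erase a).erase b).card = n := by
    rw [Finset.card_erase_of_mem (by simp [hab.symm]), Finset.card_erase_of_mem (by simp),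
      Finset.card_univ, hV]
    rfl
  have hNa : G.neighborFinset a = (Finset.univ.erase a).erase b := by
    refine Finset.eq_of_subset_of_card_le (fun x hx => ?_) (by simp [hcard, ha])
    rw [mem_neighborFinset] at hx
    simp only [Finset.mem_erase, Finset.mem_univ, and_true]
    exact ⟨by rintro rfl; exact hnadj hx, hx.ne'⟩
  have hNb : G.neighborFinset b = (Finset.univ.erase a).erase b := by
    refine Finset.eq_of_subset_of_card_le (fun x hx => ?_) (by simp [hcard, hb])
    rw [mem_neighborFinset] at hx
    simp only [Finset.mem_erase, Finset.mem_univ, and_true]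
    exact ⟨hx.ne', by rintro rfl; exact hnadj hx.symm⟩
  have hAa : ∀ x, G.Adj a x ↔ x ≠ b ∧ x ≠ a := by
    intro x; rw [← mem_neighborFinset, hNa]; simp
  have hAb : ∀ x, G.Adj b x ↔ x ≠ b ∧ x ≠ a := by
    intro x; rw [← mem_neighborFinset, hNb]; simp
  have hN : ∀ x, x ≠ a → x ≠ b → G.neighborFinset x = {a, b} := by
    intro x hxa hxb
    symm
    refine Finset.eq_of_subset_of_card_le (fun y hy => ?_)
      (by rw [card_neighborFinset_eq_degree, hd x hxa hxb, Finset.card_pair hab])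
    rw [mem_neighborFinset]
    simp only [Finset.mem_insert, Finset.mem_singleton] at hy
    rcases hy with rfl | rfl
    · exact ((hAa x).2 ⟨hxb, hxa⟩).symm
    · exact ((hAb x).2 ⟨hxb, hxa⟩).symm
  refine nonempty_iso_completeBipartiteGraph hV hab fun x y => ?_
  by_cases hxa : x = a
  · subst hxa; rw [hAa]; simp; tauto
  by_cases hxb : x = b
  · subst hxb; rw [hAb]; simp; tauto
  rw [← mem_neighborFinset, hN x hxa hxb]
  simp [hxa, hxb]

theorem exists_eq_neighbor_pair {V : Type*} [Fintype V] {G : SimpleGraph V} [DecidableRel G.Adj]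
    {v a : V} (hd : G.degree v = 2) (ha : G.Adj v a) :
    ∃ w, w ≠ a ∧ G.Adj v w ∧ ∀ x, G.Adj v x → x = a ∨ x = w := by
  classical
  have h1 : ((G.neighborFinset v).erase a).card = 1 := by
    rw [Finset.card_erase_of_mem (by simpa using ha), card_neighborFinset_eq_degree, hd]
  obtain ⟨w, hw⟩ := Finset.card_eq_one.1 h1
  have hmem : ∀ x, (x ≠ a ∧ G.Adj v x) ↔ x = w := by
    intro x
    have := Finset.ext_iff.1 hw x
    simpa using this
  have := (hmem w).2 rfl
  exact ⟨w, this.1, this.2, fun x hx => or_iff_not_imp_left.2 fun h => (hmem x).1 ⟨h, hx⟩⟩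

theorem exists_unique_nonneighbor {V : Type*} [Fintype V] {G : SimpleGraph V} [DecidableRel G.Adj]
    {a : V} (ha : G.degree a + 2 = Fintype.card V) :
    ∃ y, y ≠ a ∧ ¬ G.Adj a y ∧ ∀ x, x ≠ a → x ≠ y → G.Adj a x := by
  classical
  have h1 : ((G.neighborFinset a)ᶜ.erase a).card = 1 := by
    rw [Finset.card_erase_of_mem (by simp), Finset.card_compl, card_neighborFinset_eq_degree]
    omega
  obtain ⟨y, hy⟩ := Finset.card_eq_one.1 h1
  have hmem : ∀ x, (x ≠ a ∧ ¬ G.Adj a x) ↔ x = y := by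
    intro x
    have := Finset.ext_iff.1 hy x
    simpa using this
  have := (hmem y).2 rfl
  exact ⟨y, this.1, this.2, fun x hx hxy => by_contra fun h => hxy ((hmem x).1 ⟨hx, h⟩)⟩

theorem exists_notMem_of_card_lt {V : Type*} [Fintype V] (s : Finset V)
    (h : s.card < Fintype.card V) : ∃ x, x ∉ s := by
  by_contra! hs
  rw [Finset.eq_univ_iff_forall.2 hs, Finset.card_univ] at h
  exact h.false

/-- Two vertices of degree `n` and otherwise degree 2, on at least five vertices: if the two
were adjacent, the edge between them would be a chord. -/
theorem not_adj_of_degrees {V : Type*} [Fintype V] {G : SimpleGraph V} [DecidableRel G.Adj]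
    (h : ¬ HasChordedCycle G) {n : ℕ} (hn : 3 ≤ n) (hV : Fintype.card V = n + 2) {a b : V}
    (ha : G.degree a = n) (hb : G.degree b = n)
    (hd : ∀ v, v ≠ a → v ≠ b → G.degree v = 2) : ¬ G.Adj a b := by
  classical
  intro hab
  have hne := hab.ne
  obtain ⟨y, hya, hay, hy⟩ := exists_unique_nonneighbor (G := G) (a := a) (by omega)
  obtain ⟨z, hzb, hbz, hz⟩ := exists_unique_nonneighbor (G := G) (a := b) (by omega)
  have hyb : y ≠ b := by rintro rfl; exact hay hab
  have hza : z ≠ a := by rintro rfl; exact hbz hab.symm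
  -- the vertices other than `a`, `b`, `y`, `z` have no neighbours besides `a` and `b`
  have hfull : ∀ x, x ≠ a → x ≠ b → x ≠ y → x ≠ z → ∀ w, G.Adj x w → w = a ∨ w = b := by
    intro x hxa hxb hxy hxz w hw
    obtain ⟨w', hw'a, -, hw'⟩ := exists_eq_neighbor_pair (hd x hxa hxb) (hy x hxa hxy).symm
    have hb' := (hw' b (hz x hxb hxz).symm).resolve_left hne.symm
    rw [hb']
    exact hw' w hw
  by_cases hyz : y = z
  · subst hyz
    have hdy : 0 < G.degree y := by rw [hd y hya hyb]; norm_num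
    obtain ⟨w, hw⟩ := (G.degree_pos_iff_exists_adj y).1 hdy
    have hwa : w ≠ a := by rintro rfl; exact hay hw.symm
    have hwb : w ≠ b := by rintro rfl; exact hbz hw.symm
    exact (hfull w hwa hwb hw.ne' hw.ne' y hw.symm).elim hya hyb
  · obtain ⟨w, hwb, hyw, -⟩ := exists_eq_neighbor_pair (hd y hya hyb) (hz y hyb hyz).symm
    have hwa : w ≠ a := by rintro rfl; exact hay hyw.symm
    have hwz : w = z := by
      by_contra hwz
      exact (hfull w hwa hwb hyw.ne' hwz y hyw.symm).elim hya hyb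
    subst hwz
    obtain ⟨x, hx⟩ := exists_notMem_of_card_lt {a, b, y, w}
      (Finset.card_le_four.trans_lt (by omega))
    simp only [Finset.mem_insert, Finset.mem_singleton, not_or] at hx
    obtain ⟨hxa, hxb, hxy, hxw⟩ := hx
    exact h (hasChordedCycle_of_five (hy x hxa hxy) (hz x hxb hxw).symm (hz y hyb hyz) hyw
      (hy w hza (Ne.symm hyz)).symm hab hxy hxw hzb.symm hya.symm)

theorem nonempty_iso_of_degrees {V : Type*} [Fintype V] {G : SimpleGraph V} [DecidableRel G.Adj]
    (h : ¬ HasChordedCycle G) {n : ℕ} (hn : 2 ≤ n) (hV : Fintype.card V = n + 2) {a b : V}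
    (hab : a ≠ b) (ha : G.degree a = n) (hb : G.degree b = n)
    (hd : ∀ v, v ≠ a → v ≠ b → G.degree v = 2) :
    Nonempty (G ≃g completeBipartiteGraph (Fin 2) (Fin n)) := by
  rcases hn.eq_or_lt with rfl | hn
  · -- on four vertices all degrees are 2, and `b` may have to be replaced
    have hall : ∀ v, G.degree v = 2 := by
      intro v
      by_cases hva : v = a
      · rwa [hva]
      by_cases hvb : v = b
      · rwa [hvb]
      exact hd v hva hvb
    obtain ⟨y, hya, hay, -⟩ := exists_unique_nonneighbor (G := G) (a := a) (by omega)
    exact nonempty_iso_of_not_adj hV hya.symm hay ha (hall y) fun v _ _ => hall v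
  · exact nonempty_iso_of_not_adj hV hab (not_adj_of_degrees h hn hV ha hb hd) ha hb hd

/-! ### Windmills and the friendship graph -/

/-- `G` is a windmill of triangles with centre `c`: the centre is adjacent to all other vertices,
and every other vertex has exactly one neighbour besides `c`. -/
def IsWindmill {V : Type*} (G : SimpleGraph V) (c : V) : Prop :=
  (∀ x ≠ c, G.Adj c x) ∧ ∀ x ≠ c, ∃! y, y ≠ c ∧ G.Adj x y

theorem isWindmill_of_dominating {V : Type*} [Fintype V] {G : SimpleGraph V} [DecidableRel G.Adj]
    (h : ¬ HasChordedCycle G) (hd : ∀ v, 2 ≤ G.degree v) {c : V} (hc : ∀ x ≠ c, G.Adj c x) :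
    IsWindmill G c := by
  refine ⟨hc, fun x hx => ?_⟩
  obtain ⟨y, hyc, hxy, -⟩ := exists_eq_neighbor_pair
    ((degree_le_two_of_dominating h hc hx).antisymm (hd x)) (hc x hx).symm
  exact ⟨y, ⟨hyc, hxy⟩, fun z hz => eq_of_adj_of_dominating h hc hx hz.1 hyc hz.2 hxy⟩

/-- The involution that fixes the centre of a windmill and swaps the two outer vertices of
each triangle. -/
theorem IsWindmill.exists_perm {V : Type*} {G : SimpleGraph V} {c : V} (h : IsWindmill G c) :
    ∃ σ : Equiv.Perm V, σ ^ 2 = 1 ∧ (∀ x, σ x = x ↔ x = c) ∧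
      ∀ x y, G.Adj x y ↔ x ≠ y ∧ (x = c ∨ y = c ∨ σ x = y) := by
  classical
  choose! g hg huniq using h.2
  have hinv : ∀ x ≠ c, g (g x) = x := fun x hx =>
    (huniq (g x) (hg x hx).1 x ⟨hx, (hg x hx).2.symm⟩).symm
  let s : V → V := fun x => if x = c then c else g x
  have hs : Function.Involutive s := by
    intro x
    by_cases hx : x = c
    · simp [s, hx]
    · simp [s, hx, (hg x hx).1, hinv x hx]
  refine ⟨hs.toPerm, ?_, fun x => ?_, fun x y => ?_⟩
  · ext x
    simp [pow_two, hs x]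
  · by_cases hx : x = c
    · simp [s, hx]
    · simpa [s, hx] using (hg x hx).2.ne'
  · by_cases hx : x = c
    · subst hx
      simp only [true_or, and_true]
      exact ⟨fun hxy => hxy.ne, fun hxy => h.1 y hxy.symm⟩
    by_cases hy : y = c
    · subst hy
      simp only [true_or, or_true, and_true]
      exact ⟨fun hxy => hxy.ne, fun hxy => (h.1 x hxy).symm⟩
    simp only [hx, hy, false_or, Function.Involutive.coe_toPerm, s, if_false]
    constructor
    · intro hxy
      exact ⟨hxy.ne, (huniq x hx y ⟨hy, hxy⟩).symm⟩
    · rintro ⟨-, rfl⟩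
      exact (hg x hx).2

/-- Windmills of the same order are isomorphic, because involutions with a single fixed point
are conjugate. -/
theorem IsWindmill.nonempty_iso {V W : Type*} [Fintype V] [Fintype W] {G : SimpleGraph V}
    {H : SimpleGraph W} {c : V} {d : W} (hG : IsWindmill G c) (hH : IsWindmill H d)
    (hcard : Fintype.card V = Fintype.card W) : Nonempty (G ≃g H) := by
  classical
  obtain ⟨σ, hσ2, hσfix, hσ⟩ := hG.exists_perm
  obtain ⟨τ, hτ2, hτfix, hτ⟩ := hH.exists_perm
  let e := Fintype.equivOfCardEq hcard
  let σ' : Equiv.Perm W := (e.symm.trans σ).trans e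
  have hσ'2 : σ' ^ 2 = 1 := by
    ext x
    have := Equiv.congr_fun hσ2 (e.symm x)
    simp only [pow_two, Equiv.Perm.mul_apply, Equiv.Perm.one_apply] at this
    simp [pow_two, σ', this]
  have hσ'fix : ∀ x, σ' x = x ↔ x = e c := by
    intro x
    simp only [σ', Equiv.trans_apply, ← Equiv.eq_symm_apply, hσfix, Equiv.symm_symm]
  have hsupp : ∀ (π : Equiv.Perm W) (z : W), (∀ x, π x = x ↔ x = z) →
      π.support.card = Fintype.card W - 1 := by
    intro π z hπ
    have : π.support = Finset.univ.erase z := by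
      ext x; simp [hπ]
    rw [this, Finset.card_erase_of_mem (Finset.mem_univ z), Finset.card_univ]
  have hct : ∀ π : Equiv.Perm W, π ^ 2 = 1 →
      π.cycleType = Multiset.replicate π.cycleType.card 2 ∧
        π.cycleType.card * 2 = π.support.card := by
    intro π hπ
    have h1 := Equiv.Perm.cycleType_of_pow_prime_eq_one hπ
    refine ⟨h1, ?_⟩
    rw [← Equiv.Perm.sum_cycleType, h1]
    simp
  have hconj : IsConj σ' τ := by
    refine Equiv.Perm.isConj_of_cycleType_eq ?_
    have h1 := hct σ' hσ'2
    have h2 := hct τ hτ2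
    rw [hsupp _ _ hσ'fix] at h1
    rw [hsupp _ _ hτfix] at h2
    rw [h1.1, h2.1]
    congr 1
    omega
  obtain ⟨π, hπ⟩ := isConj_iff.1 hconj
  have hcomm : ∀ x, π (σ' x) = τ (π x) := by
    intro x
    rw [← hπ]; simp
  have hc : π (e c) = d := by
    rw [← hτfix, ← hcomm, (hσ'fix _).2 rfl]
  refine ⟨⟨e.trans π, fun {x y} => ?_⟩⟩
  have hcenter : ∀ x, π (e x) = d ↔ x = c := by
    intro x
    rw [← hc]; simp
  have hstep : ∀ x y, τ (π (e x)) = π (e y) ↔ σ x = y := by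
    intro x y
    rw [← hcomm]; simp [σ']
  simp only [Equiv.trans_apply, hτ, hσ, hcenter, hstep, ne_eq, EmbeddingLike.apply_eq_iff_eq]

theorem IsWindmill.odd_card {V : Type*} [Fintype V] {G : SimpleGraph V} {c : V}
    (h : IsWindmill G c) : Odd (Fintype.card V) := by
  classical
  obtain ⟨σ, hσ2, hσfix, -⟩ := h.exists_perm
  have hsupp : σ.support = Finset.univ.erase c := by
    ext x; simp [hσfix]
  have hsum := σ.sum_cycleType
  rw [Equiv.Perm.cycleType_of_pow_prime_eq_one (p := 2) hσ2, hsupp,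
    Finset.card_erase_of_mem (Finset.mem_univ c), Finset.card_univ, Multiset.sum_replicate,
    smul_eq_mul] at hsum
  have : 0 < Fintype.card V := Fintype.card_pos_iff.2 ⟨c⟩
  exact ⟨σ.cycleType.card, by omega⟩

theorem isWindmill_friendshipGraph {n : ℕ} (hn : Odd n) :
    IsWindmill (friendshipGraph n) ⟨0, hn.pos⟩ := by
  obtain ⟨k, hk⟩ := hn
  refine ⟨fun x hx => ⟨hx.symm, Or.inl rfl⟩, fun x hx => ?_⟩
  have hx0 : x.val ≠ 0 := fun h => hx (Fin.ext h)
  have hlt := x.isLt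
  -- the partner of `i ≥ 1` is `i + 1` for odd `i` and `i - 1` for even `i`
  refine ⟨⟨if x.val % 2 = 1 then x.val + 1 else x.val - 1, by split_ifs <;> omega⟩,
    ⟨?_, ?_, ?_⟩, ?_⟩
  · intro h
    have := congrArg Fin.val h
    simp only at this
    split_ifs at this; omega
  · intro h
    have := congrArg Fin.val h
    simp only at this
    split_ifs at this <;> omega
  · right; right
    simp only
    split_ifs
    all_goals omega
  · rintro y ⟨hy, hxy, h⟩
    have hy0 : y.val ≠ 0 := fun h => hy (Fin.ext h)
    have hne : x.val ≠ y.val := fun h => hxy (Fin.ext h)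
    ext
    simp only
    split_ifs <;> omega

/-- Removing the centre of a windmill with at least two triangles disconnects it. -/
theorem IsWindmill.not_isTConnected {V : Type*} [Fintype V] {G : SimpleGraph V} {c : V}
    (h : IsWindmill G c) (hV : 4 ≤ Fintype.card V) : ¬ IsTConnected G 2 := by
  classical
  intro hG
  have hconn := hG {c} (by simp)
  obtain ⟨x, hx⟩ := exists_notMem_of_card_lt {c} (by simp; omega)
  have hxc : x ≠ c := by simpa using hx
  obtain ⟨y, ⟨hyc, hxy⟩, -⟩ := h.2 x hxc
  obtain ⟨z, hz⟩ := exists_notMem_of_card_lt {c, x, y} (Finset.card_le_three.trans_lt (by omega))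
  simp only [Finset.mem_insert, Finset.mem_singleton, not_or] at hz
  have hclosed : ∀ u v : {v | v ∉ ({c} : Finset V)},
      (G.induce {v | v ∉ ({c} : Finset V)}).Walk u v → (u.1 = x ∨ u.1 = y) →
        (v.1 = x ∨ v.1 = y) := by
    intro u v w
    induction w with
    | nil => exact id
    | @cons u v _ huv _ ih =>
      intro hu
      refine ih ?_
      have hvc : v.1 ≠ c := by simpa using v.2
      have huv' : G.Adj u.1 v.1 := huv
      rcases hu with hu | hu
      · rw [hu] at huv'
        exact Or.inr ((h.2 x hxc).unique ⟨hvc, huv'⟩ ⟨hyc, hxy⟩)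
      · rw [hu] at huv'
        exact Or.inl ((h.2 y hyc).unique ⟨hvc, huv'⟩ ⟨hxc, hxy.symm⟩)
  obtain ⟨w⟩ := hconn.preconnected ⟨x, hx⟩ ⟨z, by simpa using hz.1⟩
  exact (hclosed _ _ w (Or.inl rfl)).elim hz.2.1 hz.2.2

/-! ### The extremal bounds -/

/-- The common core of both parts: without chorded cycles, a graph with minimum degree at least
2 and no dominating vertex is bounded by `K_{2,n-2}`. -/
theorem degreePower_le_and_eq_iff {V : Type*} [Fintype V] {G : SimpleGraph V} [DecidableRel G.Adj]
    (h : ¬ HasChordedCycle G) (hd : ∀ v, 2 ≤ G.degree v) {n p : ℕ} (hV : Fintype.card V = n)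
    (hn : 4 ≤ n) (hp : 1 < p) (hdom : ∀ c, ¬ ∀ x ≠ c, G.Adj c x) :
    degreePower G p ≤ 2 * (n - 2) ^ p + (n - 2) * 2 ^ p ∧
      (degreePower G p = 2 * (n - 2) ^ p + (n - 2) * 2 ^ p ↔
        Nonempty (G ≃g completeBipartiteGraph (Fin 2) (Fin (n - 2)))) := by
  have hV' : Fintype.card V = (n - 2) + 2 := by omega
  have hsum : ∑ v, G.degree v ≤ 4 * (n - 2) := by
    have h1 := card_edgeFinset_add_four_le G h (by omega)
    rw [G.sum_degrees_eq_twice_card_edges]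
    omega
  have hdN : ∀ v, G.degree v ≤ n - 2 := by
    intro v
    by_contra hv
    exact hdom v fun x hx => adj_of_card_le_degree_add_one (by omega) hx
  refine ⟨sum_pow_le (by omega) hV' hd hdN hsum, fun heq => ?_, fun ⟨φ⟩ => ?_⟩
  · obtain ⟨a, b, hab, ha, hb, hrest⟩ :=
      exists_of_sum_pow_eq (by omega) hp hV' hd hdN hsum heq
    exact nonempty_iso_of_degrees h (by omega) hV' hab ha hb hrest
  · rw [degreePower_congr φ, degreePower_completeBipartiteGraph]

theorem theorem2 {V : Type*} [Fintype V] (G : SimpleGraph V) [DecidableRel G.Adj]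
    (n p : ℕ) (hV : Fintype.card V = n) (hn : 4 ≤ n) (hp : 1 < p) :
    (IsMinimallyConnected G 2 →
      degreePower G p ≤ 2 * (n - 2) ^ p + (n - 2) * 2 ^ p ∧
      (degreePower G p = 2 * (n - 2) ^ p + (n - 2) * 2 ^ p ↔
        Nonempty (G ≃g completeBipartiteGraph (Fin 2) (Fin (n - 2))))) ∧
    (IsMinimallyEdgeConnected G 2 →
      degreePower G p ≤ max (degreePower (friendshipGraph n) p)
        (degreePower (completeBipartiteGraph (Fin 2) (Fin (n - 2))) p) ∧
      (degreePower G p = max (degreePower (friendshipGraph n) p)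
          (degreePower (completeBipartiteGraph (Fin 2) (Fin (n - 2))) p) ↔
        (Odd n ∧ Nonempty (G ≃g friendshipGraph n) ∧
          degreePower (completeBipartiteGraph (Fin 2) (Fin (n - 2))) p ≤
            degreePower (friendshipGraph n) p) ∨
        (Nonempty (G ≃g completeBipartiteGraph (Fin 2) (Fin (n - 2))) ∧
          degreePower (friendshipGraph n) p ≤
            degreePower (completeBipartiteGraph (Fin 2) (Fin (n - 2))) p)) ∧
      (Even n →
        degreePower G p ≤ degreePower (completeBipartiteGraph (Fin 2) (Fin (n - 2))) p ∧
        (degreePower G p = degreePower (completeBipartiteGraph (Fin 2) (Fin (n - 2))) p ↔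
          Nonempty (G ≃g completeBipartiteGraph (Fin 2) (Fin (n - 2)))))) := by
  constructor
  · intro hG
    have hchord := hG.not_hasChordedCycle
    have hdeg := hG.1.two_le_degree (by omega)
    exact degreePower_le_and_eq_iff hchord hdeg hV hn hp fun c hc =>
      (isWindmill_of_dominating hchord hdeg hc).not_isTConnected (by omega) hG.1
  · intro hG
    have hchord := hG.not_hasChordedCycle
    have : Nontrivial V := Fintype.one_lt_card_iff_nontrivial.1 (by omega)
    have hdeg : ∀ v, 2 ≤ G.degree v := fun v => hG.1.le_degree
    by_cases hdom : ∃ c, ∀ x ≠ c, G.Adj c x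
    · obtain ⟨c, hc⟩ := hdom
      have hw := isWindmill_of_dominating hchord hdeg hc
      have hodd : Odd n := hV ▸ hw.odd_card
      obtain ⟨φ⟩ := hw.nonempty_iso (isWindmill_friendshipGraph hodd) (by simp [hV])
      have hF := degreePower_congr φ p
      refine ⟨hF ▸ le_max_left _ _, ⟨fun heq => ?_, ?_⟩, fun he => ?_⟩
      · exact Or.inl ⟨hodd, ⟨φ⟩, (le_max_right _ _).trans (heq.symm.trans hF).le⟩
      · rintro (⟨-, -, hle⟩ | ⟨⟨ψ⟩, hle⟩)
        · rw [hF, max_eq_left hle]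
        · rw [degreePower_congr ψ, max_eq_right hle]
      · exact absurd he (Nat.not_even_iff_odd.2 hodd)
    · push Not at hdom
      have key := degreePower_le_and_eq_iff hchord hdeg hV hn hp fun c hc => by
        obtain ⟨x, hx, hn⟩ := hdom c
        exact hn (hc x hx)
      rw [← degreePower_completeBipartiteGraph] at key
      refine ⟨key.1.trans (le_max_right _ _), ⟨fun heq => ?_, ?_⟩, fun _ => key⟩
      · have hK := key.1.antisymm ((le_max_right _ _).trans heq.ge)
        exact Or.inr ⟨key.2.1 hK, (le_max_left _ _).trans (heq.symm.trans hK).le⟩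
      · rintro (⟨-, ⟨φ⟩, hle⟩ | ⟨hψ, hle⟩)
        · rw [degreePower_congr φ, max_eq_left hle]
        · rw [key.2.2 hψ, max_eq_right hle]
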